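/- Let $n\ge 1$ and let $(M,\varphi,\xi,\eta,g)$ be an almost contact B-metric manifold of dimension $2n+1$: $M$ is a smooth manifold, $\varphi$ a smooth endomorphism of $TM$, $\xi$ a smooth vector field, $\eta$ a smooth $1$-form and $g$ a smooth pseudo-Riemannian metric with $$\varphi\xi=0,\quad \varphi^2=-\mathrm{Id}+\eta\otimes\xi,\quad \eta\circ\varphi=0,\quad \eta(\xi)=1,\quad g(\varphi x,\varphi y)=-g(x,y)+\eta(x)\eta(y)$$ (so that $g$ is necessarily positive on $\xi$ and of neutral signature on $\ker\eta$). Let $\nabla$ be the Levi-Civita connection of $g$, let $$N(x,y)=[\varphi x,\varphi y]+\varphi^2[x,y]-\varphi[\varphi x,y]-\varphi[x,\varphi y]+\mathrm d\eta(x,y)\,\xi,\qquad \mathrm d\eta(x,y)=x\,\eta(y)-y\,\eta(x)-\eta([x,y]),$$ and $N(x,y,z)=g(N(x,y),z)$. The $\varphi$-canonical connection $\nabla'$ of $(M,\varphi,\xi,\eta,g)$ is the linear connection given by $$g(\nabla'_xy,z)=g(\nabla_xy,z)+g\bigl(Q^0(x,y),z\bigr)-\tfrac18\bigl\{N(\varphi^2z,\varphi^2y,\varphi^2x)+2N(\varphi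 z,\varphi y,\xi)\,\eta(x)\bigr\},$$ $$Q^0(x,y)=\tfrac12\bigl\{(\nabla_x\varphi)\varphi y+(\nabla_x\eta)(y)\,\xi\bigr\}-\eta(y)\nabla_x\xi .$$ Let $T'(x,y)=\nabla'_xy-\nabla'_yx-[x,y]$ be its torsion. For smooth functions $u,v,w$ on $M$, the general contactly conformal transformation with parameters $(u,v,w)$ replaces $(\varphi,\xi,\eta,g)$ by the almost contact B-metric structure $(\varphi,\bar\xi,\bar\eta,\bar g)$ with $$\bar\xi=e^{-w}\xi,\quad \bar\eta=e^{w}\eta,\quad \bar g(x,y)=\alpha\,g(x,y)+\beta\,g(x,\varphi y)+(\gamma-\alpha)\,\eta(x)\eta(y),$$ $$\alpha=e^{2u}\cos 2v,\quad \beta=e^{2u}\sin 2v,\quad \gamma=e^{2w}.$$ These transformations form a group $G$, in which composition corresponds to addition of the parameters. Let $G_0\subset G$ be the subgroup given by the conditions $$\mathrm du\circ\varphi^2+\mathrm dv\circ\varphi=0,\quad \mathrm du\circ\varphi-\mathrm dv\circ\varphi^2=0,\quad \mathrm du(\xi)=0,\quad \mathrm dv(\xi)=0,\quad \mathrm dw\circ\varphi=0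 .$$ Let $\bar T'$ be the torsion of the $\varphi$-canonical connection of $(M,\varphi,\bar\xi,\bar\eta,\bar g)$. Then $\bar T'=T'$ as tensors of type $(1,2)$ on $M$ if and only if the transformation belongs to $G_0$. -/

import Mathlib

set_option linter.unusedSectionVars false

open scoped Manifold ContDiff Bundle

noncomputable section

/-- Composition of smooth sections of `Hom` bundles over the tangent bundle is smooth. -/
theorem contMDiff_section_clm_comp
    {E : Type*} [NormedAddCommGroup E] [NormedSpace ℝ E]
    {M : Type*} [TopologicalSpace M] [ChartedSpace E M] [IsManifold 𝓘(ℝ, E) ∞ M]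
    {phi : Π p : M, TangentSpace 𝓘(ℝ, E) p →L[ℝ] TangentSpace 𝓘(ℝ, E) p}
    {g : Π p : M, TangentSpace 𝓘(ℝ, E) p →L[ℝ] TangentSpace 𝓘(ℝ, E) p →L[ℝ] ℝ}
    (hphi : ContMDiff 𝓘(ℝ, E) (𝓘(ℝ, E).prod 𝓘(ℝ, E →L[ℝ] E)) ∞
      (fun p ↦ Bundle.TotalSpace.mk' (E →L[ℝ] E) p (phi p)))
    (hg : ContMDiff 𝓘(ℝ, E) (𝓘(ℝ, E).prod 𝓘(ℝ, E →L[ℝ] E →L[ℝ] ℝ)) ∞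
      (fun p ↦ Bundle.TotalSpace.mk' (E →L[ℝ] E →L[ℝ] ℝ) p (g p))) :
    ContMDiff 𝓘(ℝ, E) (𝓘(ℝ, E).prod 𝓘(ℝ, E →L[ℝ] E →L[ℝ] ℝ)) ∞
      (fun p ↦ Bundle.TotalSpace.mk' (E →L[ℝ] E →L[ℝ] ℝ) p ((g p).comp (phi p))) := by
  intro p₀
  have h1 := (contMDiffAt_hom_bundle _).1 (hphi p₀)
  have h2 := (contMDiffAt_hom_bundle _).1 (hg p₀)
  refine (contMDiffAt_hom_bundle _).2 ⟨h1.1, ?_⟩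
  refine (h2.2.clm_comp h1.2).congr_of_eventuallyEq ?_
  have hb : (trivializationAt E (TangentSpace 𝓘(ℝ, E)) p₀).baseSet ∈ nhds p₀ :=
    (trivializationAt E (TangentSpace 𝓘(ℝ, E)) p₀).open_baseSet.mem_nhds
      (FiberBundle.mem_baseSet_trivializationAt' p₀)
  filter_upwards [hb] with p hp
  ext x y
  simp only [ContinuousLinearMap.inCoordinates, ContinuousLinearMap.comp_apply]
  erw [Bundle.Trivialization.symmL_continuousLinearMapAt _ hp]


/-- An almost contact B-metric structure on a smooth manifold `M` modelled on `E`: a smooth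
endomorphism field `phi`, a smooth vector field `xi`, a smooth 1-form `eta` and a smooth
pseudo-Riemannian metric `g` with `φξ = 0`, `φ² = -Id + η ⊗ ξ`, `η ∘ φ = 0`, `η(ξ) = 1` and
`g(φx, φy) = -g(x, y) + η(x)η(y)`. The last identity forces `g(ξ, ξ) = 1` and neutral signature of
`g` on `ker η`, so the signature of `g` needs no separate field. -/
@[ext]
structure AlmostContactBMetric
    (E : Type*) [NormedAddCommGroup E] [NormedSpace ℝ E]
    (M : Type*) [TopologicalSpace M] [ChartedSpace E M] [IsManifold 𝓘(ℝ, E) ∞ M] where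
  phi : Π p : M, TangentSpace 𝓘(ℝ, E) p →L[ℝ] TangentSpace 𝓘(ℝ, E) p
  xi : Π p : M, TangentSpace 𝓘(ℝ, E) p
  eta : Π p : M, TangentSpace 𝓘(ℝ, E) p →L[ℝ] ℝ
  g : Π p : M, TangentSpace 𝓘(ℝ, E) p →L[ℝ] TangentSpace 𝓘(ℝ, E) p →L[ℝ] ℝ
  smooth_phi : ContMDiff 𝓘(ℝ, E) (𝓘(ℝ, E).prod 𝓘(ℝ, E →L[ℝ] E)) ∞
    (fun p ↦ Bundle.TotalSpace.mk' (E →L[ℝ] E) p (phi p))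
  smooth_xi : ContMDiff 𝓘(ℝ, E) (𝓘(ℝ, E).prod 𝓘(ℝ, E)) ∞
    (fun p ↦ Bundle.TotalSpace.mk' E p (xi p))
  smooth_eta : ContMDiff 𝓘(ℝ, E) (𝓘(ℝ, E).prod 𝓘(ℝ, E →L[ℝ] ℝ)) ∞
    (fun p ↦ Bundle.TotalSpace.mk' (E →L[ℝ] ℝ) p (eta p))
  smooth_g : ContMDiff 𝓘(ℝ, E) (𝓘(ℝ, E).prod 𝓘(ℝ, E →L[ℝ] E →L[ℝ] ℝ)) ∞
    (fun p ↦ Bundle.TotalSpace.mk' (E →L[ℝ] E →L[ℝ] ℝ) p (g p))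
  phi_xi : ∀ p, phi p (xi p) = 0
  phi_phi : ∀ p x, phi p (phi p x) = -x + eta p x • xi p
  eta_phi : ∀ p x, eta p (phi p x) = 0
  eta_xi : ∀ p, eta p (xi p) = 1
  g_symm : ∀ p x y, g p x y = g p y x
  g_nondegenerate : ∀ p x, (∀ y, g p x y = 0) → x = 0
  g_phi_phi : ∀ p x y, g p (phi p x) (phi p y) = -g p x y + eta p x * eta p y

namespace AlmostContactBMetric

variable {E : Type*} [NormedAddCommGroup E] [NormedSpace ℝ E]
  {M : Type*} [TopologicalSpace M] [ChartedSpace E M] [IsManifold 𝓘(ℝ, E) ∞ M]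

theorem g_xi (S : AlmostContactBMetric E M) (p : M) (x : TangentSpace 𝓘(ℝ, E) p) :
    S.g p x (S.xi p) = S.eta p x := by
  have h := S.g_phi_phi p x (S.xi p)
  rw [S.phi_xi, map_zero, S.eta_xi] at h
  linarith

theorem g_phi_left (S : AlmostContactBMetric E M) (p : M) (x y : TangentSpace 𝓘(ℝ, E) p) :
    S.g p (S.phi p x) y = S.g p x (S.phi p y) := by
  have h := S.g_phi_phi p x (S.phi p y)
  rw [S.phi_phi, map_add, map_neg, map_smul, S.g_xi, S.eta_phi, S.eta_phi] at h
  simp only [smul_eq_mul, mul_zero, add_zero] at h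
  linarith

/-- The field `X ↦ φX` for a vector field `X`. -/
def phiField (S : AlmostContactBMetric E M) (X : Π p : M, TangentSpace 𝓘(ℝ, E) p) :
    Π p : M, TangentSpace 𝓘(ℝ, E) p :=
  fun p ↦ S.phi p (X p)

/-- The exterior derivative `dη(X, Y) = X(η(Y)) - Y(η(X)) - η([X, Y])`. -/
def dEta (S : AlmostContactBMetric E M) (X Y : Π p : M, TangentSpace 𝓘(ℝ, E) p) (p : M) : ℝ :=
  mvfderiv 𝓘(ℝ, E) (fun q ↦ S.eta q (Y q)) p (X p)
    - mvfderiv 𝓘(ℝ, E) (fun q ↦ S.eta q (X q)) p (Y p)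
    - S.eta p (VectorField.mlieBracket 𝓘(ℝ, E) X Y p)

/-- The Nijenhuis tensor `N = [φ, φ] + dη ⊗ ξ`, where
`[φ, φ](X, Y) = [φX, φY] + φ²[X, Y] - φ[φX, Y] - φ[X, φY]`. -/
def nijenhuis (S : AlmostContactBMetric E M) (X Y : Π p : M, TangentSpace 𝓘(ℝ, E) p) (p : M) :
    TangentSpace 𝓘(ℝ, E) p :=
  VectorField.mlieBracket 𝓘(ℝ, E) (S.phiField X) (S.phiField Y) p
    + S.phi p (S.phi p (VectorField.mlieBracket 𝓘(ℝ, E) X Y p))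
    - S.phi p (VectorField.mlieBracket 𝓘(ℝ, E) (S.phiField X) Y p)
    - S.phi p (VectorField.mlieBracket 𝓘(ℝ, E) X (S.phiField Y) p)
    + S.dEta X Y p • S.xi p

/-- `N(X, Y, Z) = g(N(X, Y), Z)`. -/
def nijenhuisLow (S : AlmostContactBMetric E M) (X Y Z : Π p : M, TangentSpace 𝓘(ℝ, E) p)
    (p : M) : ℝ :=
  S.g p (S.nijenhuis X Y p) (Z p)

/-- `(∇_X φ)Y = ∇_X(φY) - φ(∇_X Y)`. -/
def covPhi (S : AlmostContactBMetric E M)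
    (nabla : CovariantDerivative 𝓘(ℝ, E) E (TangentSpace 𝓘(ℝ, E) : M → Type _))
    (X Y : Π p : M, TangentSpace 𝓘(ℝ, E) p) (p : M) : TangentSpace 𝓘(ℝ, E) p :=
  nabla (S.phiField Y) p (X p) - S.phi p (nabla Y p (X p))

/-- `(∇_X η)Y = X(η(Y)) - η(∇_X Y)`. -/
def covEta (S : AlmostContactBMetric E M)
    (nabla : CovariantDerivative 𝓘(ℝ, E) E (TangentSpace 𝓘(ℝ, E) : M → Type _))
    (X Y : Π p : M, TangentSpace 𝓘(ℝ, E) p) (p : M) : ℝ :=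
  mvfderiv 𝓘(ℝ, E) (fun q ↦ S.eta q (Y q)) p (X p) - S.eta p (nabla Y p (X p))

/-- The difference between the `φB`-connection and `∇`:
`Q⁰(X, Y) = ½{(∇_X φ)φY + (∇_X η)Y · ξ} - η(Y)∇_X ξ`. -/
def phiBDifference (S : AlmostContactBMetric E M)
    (nabla : CovariantDerivative 𝓘(ℝ, E) E (TangentSpace 𝓘(ℝ, E) : M → Type _))
    (X Y : Π p : M, TangentSpace 𝓘(ℝ, E) p) (p : M) : TangentSpace 𝓘(ℝ, E) p :=
  (1 / 2 : ℝ) • (S.covPhi nabla X (S.phiField Y) p + S.covEta nabla X Y p • S.xi p)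
    - S.eta p (Y p) • nabla S.xi p (X p)

/-- `Q'(X, Y, Z) = g(Q⁰(X, Y), Z) - ⅛{N(φ²Z, φ²Y, φ²X) + 2N(φZ, φY, ξ)η(X)}`. -/
def phiCanonicalDifference (S : AlmostContactBMetric E M)
    (nabla : CovariantDerivative 𝓘(ℝ, E) E (TangentSpace 𝓘(ℝ, E) : M → Type _))
    (X Y Z : Π p : M, TangentSpace 𝓘(ℝ, E) p) (p : M) : ℝ :=
  S.g p (S.phiBDifference nabla X Y p) (Z p)
    - (1 / 8 : ℝ) *
      (S.nijenhuisLow (S.phiField (S.phiField Z)) (S.phiField (S.phiField Y))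
          (S.phiField (S.phiField X)) p
        + 2 * S.nijenhuisLow (S.phiField Z) (S.phiField Y) S.xi p * S.eta p (X p))

/-- `∇` is the Levi-Civita connection of `g`: it is torsion-free and `∇g = 0`. -/
def IsLeviCivita [CompleteSpace E] [FiniteDimensional ℝ E] (S : AlmostContactBMetric E M)
    (nabla : CovariantDerivative 𝓘(ℝ, E) E (TangentSpace 𝓘(ℝ, E) : M → Type _)) : Prop :=
  nabla.torsion = 0 ∧
    ∀ (p : M) (X Y Z : Π q : M, TangentSpace 𝓘(ℝ, E) q),
      MDifferentiableAt 𝓘(ℝ, E) (𝓘(ℝ, E).prod 𝓘(ℝ, E)) (fun q ↦ Bundle.TotalSpace.mk' E q (Y q)) p →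
      MDifferentiableAt 𝓘(ℝ, E) (𝓘(ℝ, E).prod 𝓘(ℝ, E)) (fun q ↦ Bundle.TotalSpace.mk' E q (Z q)) p →
      mvfderiv 𝓘(ℝ, E) (fun q ↦ S.g q (Y q) (Z q)) p (X p)
        = S.g p (nabla Y p (X p)) (Z p) + S.g p (Y p) (nabla Z p (X p))

/-- `D` is the `φ`-canonical connection: `g(D_X Y, Z) = g(∇_X Y, Z) + Q'(X, Y, Z)` with `∇` the
Levi-Civita connection of `g`. -/
def IsPhiCanonical [CompleteSpace E] [FiniteDimensional ℝ E] (S : AlmostContactBMetric E M)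
    (D : CovariantDerivative 𝓘(ℝ, E) E (TangentSpace 𝓘(ℝ, E) : M → Type _)) : Prop :=
  ∃ nabla : CovariantDerivative 𝓘(ℝ, E) E (TangentSpace 𝓘(ℝ, E) : M → Type _),
    S.IsLeviCivita nabla ∧
    ∀ (p : M) (X Y Z : Π q : M, TangentSpace 𝓘(ℝ, E) q),
      MDifferentiableAt 𝓘(ℝ, E) (𝓘(ℝ, E).prod 𝓘(ℝ, E)) (fun q ↦ Bundle.TotalSpace.mk' E q (X q)) p →
      MDifferentiableAt 𝓘(ℝ, E) (𝓘(ℝ, E).prod 𝓘(ℝ, E)) (fun q ↦ Bundle.TotalSpace.mk' E q (Y q)) p →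
      MDifferentiableAt 𝓘(ℝ, E) (𝓘(ℝ, E).prod 𝓘(ℝ, E)) (fun q ↦ Bundle.TotalSpace.mk' E q (Z q)) p →
      S.g p (D Y p (X p)) (Z p)
        = S.g p (nabla Y p (X p)) (Z p) + S.phiCanonicalDifference nabla X Y Z p

/-- The parameters `(u, v, w)` of the general contactly conformal transformations. Composition of
transformations corresponds to addition of parameters, see `transform_add`. -/
abbrev ConformalParam (E : Type*) [NormedAddCommGroup E] [NormedSpace ℝ E]
    (M : Type*) [TopologicalSpace M] [ChartedSpace E M] : Type _ :=
  C^∞⟮𝓘(ℝ, E), M; ℝ⟯ × C^∞⟮𝓘(ℝ, E), M; ℝ⟯ × C^∞⟮𝓘(ℝ, E), M; ℝ⟯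

/-- `α = e^{2u} cos 2v`. -/
def alpha (a : ConformalParam E M) (p : M) : ℝ := Real.exp (2 * a.1 p) * Real.cos (2 * a.2.1 p)

/-- `β = e^{2u} sin 2v`. -/
def beta (a : ConformalParam E M) (p : M) : ℝ := Real.exp (2 * a.1 p) * Real.sin (2 * a.2.1 p)

/-- `γ = e^{2w}`. -/
def gamma (a : ConformalParam E M) (p : M) : ℝ := Real.exp (2 * a.2.2 p)

/-- `ḡ(x, y) = α g(x, y) + β g(x, φy) + (γ - α) η(x)η(y)`; the code uses `g(φx, y) = g(x, φy)`,
see `gBar_apply`. -/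
def gBar (S : AlmostContactBMetric E M) (a : ConformalParam E M) (p : M) :
    TangentSpace 𝓘(ℝ, E) p →L[ℝ] TangentSpace 𝓘(ℝ, E) p →L[ℝ] ℝ :=
  alpha a p • S.g p
    + beta a p • (S.g p).comp (S.phi p)
    + (gamma a p - alpha a p) • (S.eta p).smulRight (S.eta p)

theorem gBar_apply (S : AlmostContactBMetric E M) (a : ConformalParam E M) (p : M)
    (x y : TangentSpace 𝓘(ℝ, E) p) :
    S.gBar a p x y = alpha a p * S.g p x y + beta a p * S.g p x (S.phi p y)
      + (gamma a p - alpha a p) * (S.eta p x * S.eta p y) := by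
  simp [gBar, S.g_phi_left]

theorem smooth_etaEta (S : AlmostContactBMetric E M) :
    ContMDiff 𝓘(ℝ, E) (𝓘(ℝ, E).prod 𝓘(ℝ, E →L[ℝ] E →L[ℝ] ℝ)) ∞
      (fun p ↦ Bundle.TotalSpace.mk' (E →L[ℝ] E →L[ℝ] ℝ) p
        ((S.eta p).smulRight (S.eta p) :
          TangentSpace 𝓘(ℝ, E) p →L[ℝ] TangentSpace 𝓘(ℝ, E) p →L[ℝ] ℝ)) := by
  have h := S.smooth_g.add_section
    (contMDiff_section_clm_comp S.smooth_phi (contMDiff_section_clm_comp S.smooth_phi S.smooth_g))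
  convert h using 3 with p
  ext x y
  simp [S.phi_phi, S.g_symm p (S.xi p) y, S.g_xi]

theorem smooth_alpha (a : ConformalParam E M) : ContMDiff 𝓘(ℝ, E) 𝓘(ℝ, ℝ) ∞ (alpha a) := by
  have h1 := a.1.contMDiff
  have h2 := a.2.1.contMDiff
  exact (Real.contDiff_exp.contMDiff.comp (contMDiff_const.mul h1)).mul
    (Real.contDiff_cos.contMDiff.comp (contMDiff_const.mul h2))

theorem smooth_beta (a : ConformalParam E M) : ContMDiff 𝓘(ℝ, E) 𝓘(ℝ, ℝ) ∞ (beta a) := by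
  have h1 := a.1.contMDiff
  have h2 := a.2.1.contMDiff
  exact (Real.contDiff_exp.contMDiff.comp (contMDiff_const.mul h1)).mul
    (Real.contDiff_sin.contMDiff.comp (contMDiff_const.mul h2))

theorem smooth_gamma (a : ConformalParam E M) : ContMDiff 𝓘(ℝ, E) 𝓘(ℝ, ℝ) ∞ (gamma a) :=
  Real.contDiff_exp.contMDiff.comp (contMDiff_const.mul a.2.2.contMDiff)

theorem smooth_gBar (S : AlmostContactBMetric E M) (a : ConformalParam E M) :
    ContMDiff 𝓘(ℝ, E) (𝓘(ℝ, E).prod 𝓘(ℝ, E →L[ℝ] E →L[ℝ] ℝ)) ∞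
      (fun p ↦ Bundle.TotalSpace.mk' (E →L[ℝ] E →L[ℝ] ℝ) p (S.gBar a p)) :=
  (((smooth_alpha a).smul_section S.smooth_g).add_section
    ((smooth_beta a).smul_section (contMDiff_section_clm_comp S.smooth_phi S.smooth_g))).add_section
    (((smooth_gamma a).sub (smooth_alpha a)).smul_section S.smooth_etaEta)

theorem gBar_nondegenerate (S : AlmostContactBMetric E M) (a : ConformalParam E M) (p : M)
    (x : TangentSpace 𝓘(ℝ, E) p) (h : ∀ y, S.gBar a p x y = 0) : x = 0 := by
  have hγ : gamma a p ≠ 0 := (Real.exp_pos _).ne'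
  have hαβ : alpha a p ^ 2 + beta a p ^ 2 ≠ 0 := by
    have : alpha a p ^ 2 + beta a p ^ 2 = Real.exp (2 * a.1 p) ^ 2 := by
      simp only [alpha, beta]
      linear_combination Real.exp (2 * a.1 p) ^ 2 * Real.sin_sq_add_cos_sq (2 * a.2.1 p)
    rw [this]
    positivity
  have hη : S.eta p x = 0 := by
    have := h (S.xi p)
    rw [gBar_apply, S.g_xi, S.phi_xi, S.eta_xi, map_zero] at this
    have h2 : gamma a p * S.eta p x = 0 := by linear_combination this
    exact (mul_eq_zero.1 h2).resolve_left hγ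
  have h0 : ∀ y, alpha a p * S.g p x y + beta a p * S.g p x (S.phi p y) = 0 := by
    intro y
    have := h y
    rw [gBar_apply, hη] at this
    linear_combination this
  refine S.g_nondegenerate p x fun y ↦ ?_
  have h1 := h0 y
  have h2 := h0 (S.phi p y)
  rw [S.phi_phi, map_add, map_neg, map_smul, S.g_xi, hη, smul_zero, add_zero] at h2
  refine (mul_eq_zero.1 (?_ : (alpha a p ^ 2 + beta a p ^ 2) * S.g p x y = 0)).resolve_left hαβ
  linear_combination alpha a p * h1 - beta a p * h2

/-- The general contactly conformal transformation with parameters `(u, v, w)`: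
`ξ̄ = e^{-w} ξ`, `η̄ = e^w η`, and `ḡ` as in `gBar_apply`; `φ` is unchanged. -/
def transform (S : AlmostContactBMetric E M) (a : ConformalParam E M) :
    AlmostContactBMetric E M where
  phi := S.phi
  xi := fun p ↦ Real.exp (-a.2.2 p) • S.xi p
  eta := fun p ↦ Real.exp (a.2.2 p) • S.eta p
  g := S.gBar a
  smooth_phi := S.smooth_phi
  smooth_xi := (Real.contDiff_exp.contMDiff.comp a.2.2.contMDiff.neg).smul_section S.smooth_xi
  smooth_eta := (Real.contDiff_exp.contMDiff.comp a.2.2.contMDiff).smul_section S.smooth_eta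
  smooth_g := S.smooth_gBar a
  phi_xi := by simp [S.phi_xi]
  phi_phi := by
    intro p x
    simp only [S.phi_phi, smul_apply, smul_smul, smul_eq_mul]
    rw [mul_right_comm, ← Real.exp_add, add_neg_cancel, Real.exp_zero, one_mul]
  eta_phi := by simp [S.eta_phi]
  eta_xi := by
    intro p
    simp [S.eta_xi, ← Real.exp_add]
  g_symm := by
    intro p x y
    rw [gBar_apply, gBar_apply, S.g_symm p x y, ← S.g_phi_left, S.g_symm p (S.phi p x) y]
    ring
  g_nondegenerate := S.gBar_nondegenerate a
  g_phi_phi := by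
    intro p x y
    have h2 : gamma a p = Real.exp (a.2.2 p) * Real.exp (a.2.2 p) := by
      rw [gamma, two_mul, Real.exp_add]
    simp only [gBar_apply, smul_apply, smul_eq_mul, S.g_phi_phi, S.eta_phi, h2]
    ring

theorem transform_zero (S : AlmostContactBMetric E M) : S.transform 0 = S := by
  ext p <;> simp [transform, gBar, alpha, beta, gamma]

theorem transform_add (S : AlmostContactBMetric E M) (a b : ConformalParam E M) :
    S.transform (a + b) = (S.transform a).transform b := by
  have hg : ∀ p x y, (S.transform (a + b)).g p x y = ((S.transform a).transform b).g p x y := by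
    intro p x y
    change S.gBar (a + b) p x y = (S.transform a).gBar b p x y
    rw [gBar_apply, gBar_apply]
    change _ = alpha b p * S.gBar a p x y + beta b p * S.gBar a p x (S.phi p y)
      + (gamma b p - alpha b p) *
        ((Real.exp (a.2.2 p) * S.eta p x) * (Real.exp (a.2.2 p) * S.eta p y))
    simp only [gBar_apply, S.phi_phi, S.eta_phi, map_add, map_neg, map_smul, S.g_xi, smul_eq_mul]
    have e1 : alpha (a + b) p = alpha a p * alpha b p - beta a p * beta b p := by
      simp [alpha, beta, mul_add, Real.exp_add, Real.cos_add]
      ring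
    have e2 : beta (a + b) p = alpha a p * beta b p + beta a p * alpha b p := by
      simp [alpha, beta, mul_add, Real.exp_add, Real.sin_add]
      ring
    have e3 : gamma (a + b) p = gamma a p * gamma b p := by
      simp [gamma, mul_add, Real.exp_add]
    have e4 : gamma a p = Real.exp (a.2.2 p) * Real.exp (a.2.2 p) := by
      rw [gamma, two_mul, Real.exp_add]
    rw [e1, e2, e3, e4]
    ring
  have hxi : (S.transform (a + b)).xi = ((S.transform a).transform b).xi := by
    funext p
    simp [transform, smul_smul, ← Real.exp_add]
  have heta : (S.transform (a + b)).eta = ((S.transform a).transform b).eta := by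
    funext p
    simp [transform, smul_smul, ← Real.exp_add, add_comm]
  refine AlmostContactBMetric.ext rfl hxi heta ?_
  funext p
  ext x y
  exact hg p x y

/-- The subgroup `G₀`, given by
`du ∘ φ² + dv ∘ φ = du ∘ φ - dv ∘ φ² = du(ξ) = dv(ξ) = dw ∘ φ = 0`. -/
def G0 (S : AlmostContactBMetric E M) : AddSubgroup (ConformalParam E M) where
  carrier := {a | ∀ p : M,
    (∀ x : TangentSpace 𝓘(ℝ, E) p,
      mvfderiv 𝓘(ℝ, E) a.1 p (S.phi p (S.phi p x)) + mvfderiv 𝓘(ℝ, E) a.2.1 p (S.phi p x) = 0) ∧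
    (∀ x : TangentSpace 𝓘(ℝ, E) p,
      mvfderiv 𝓘(ℝ, E) a.1 p (S.phi p x) - mvfderiv 𝓘(ℝ, E) a.2.1 p (S.phi p (S.phi p x)) = 0) ∧
    mvfderiv 𝓘(ℝ, E) a.1 p (S.xi p) = 0 ∧
    mvfderiv 𝓘(ℝ, E) a.2.1 p (S.xi p) = 0 ∧
    ∀ x : TangentSpace 𝓘(ℝ, E) p, mvfderiv 𝓘(ℝ, E) a.2.2 p (S.phi p x) = 0}
  zero_mem' := by
    intro p
    simp
  add_mem' := by
    have h : ∀ (p : M) (f g : C^∞⟮𝓘(ℝ, E), M; ℝ⟯), mvfderiv 𝓘(ℝ, E) ((f + g :) : M → ℝ) p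
        = mvfderiv 𝓘(ℝ, E) f p + mvfderiv 𝓘(ℝ, E) g p := fun p f g ↦
      mvfderiv_add (f.contMDiff.mdifferentiableAt (by simp))
        (g.contMDiff.mdifferentiableAt (by simp))
    intro a b ha hb p
    obtain ⟨a1, a2, a3, a4, a5⟩ := ha p
    obtain ⟨b1, b2, b3, b4, b5⟩ := hb p
    simp only [Prod.fst_add, Prod.snd_add, h, add_apply]
    refine ⟨fun x ↦ ?_, fun x ↦ ?_, ?_, ?_, fun x ↦ ?_⟩
    · linear_combination a1 x + b1 x
    · linear_combination a2 x + b2 x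
    · linear_combination a3 + b3
    · linear_combination a4 + b4
    · linear_combination a5 x + b5 x
  neg_mem' := by
    have h : ∀ (p : M) (f : C^∞⟮𝓘(ℝ, E), M; ℝ⟯), mvfderiv 𝓘(ℝ, E) ((-f :) : M → ℝ) p
        = -mvfderiv 𝓘(ℝ, E) f p := fun p f ↦ mvfderiv_neg
    intro a ha p
    obtain ⟨a1, a2, a3, a4, a5⟩ := ha p
    simp only [Prod.fst_neg, Prod.snd_neg, h, neg_apply]
    refine ⟨fun x ↦ ?_, fun x ↦ ?_, ?_, ?_, fun x ↦ ?_⟩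
    · linear_combination -a1 x
    · linear_combination -a2 x
    · linear_combination -a3
    · linear_combination -a4
    · linear_combination -a5 x

end AlmostContactBMetric

end

/-! Both φ-canonical connections preserve their structures, so everything is governed by their
difference `s x y`. It commutes with φ in `y`, scales ξ and η by `dw`, and its metric symmetrization
is fixed by `du` and `dv` (`difference_phi`, `difference_xi`, `difference_eta`, `difference_g`).
Since the Lie bracket cancels, equality of torsions means exactly that `s` is symmetric
(`torsion_sub_torsion`).

The torsion of a φ-canonical connection satisfies three linear conditions, `IsCanonicalTorsion`.
View φ as a complex structure on ker η. `mixed` concerns the part of T antilinear in x and linear in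
y, and makes it g-symmetric in its last two slots; `holomorphic` makes the horizontal part of the
complex bilinear component of T vanish; `vertical` is a symmetry of T(ξ, ·). These conditions
survive the change of metric (`IsCanonicalTorsion.conformal`), so the difference of the two torsions
satisfies them too.

Hence, by `symmetric_difference_iff`, the part of `s` antilinear in x and the map `s ξ` on ker η are
multiplications by complex numbers built from `du` and `dv`, while the bilinear part of `s` is
symmetric on ker η. Since `s` is complex linear in y, symmetry forces its antilinear part to vanish:
u + iv is holomorphic along ker η. Comparing `s ξ y` with `s y ξ` yields the conditions on `du ξ`,
`dv ξ` and `dw`. Conversely these conditions leave only symmetric components. -/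

/-! ### Linear algebra at a point: structures and conditions. -/

/-- A vector space with an almost contact B-metric structure. -/
structure IsBMetricSpace {V : Type*} [AddCommGroup V] [Module ℝ V] [TopologicalSpace V]
    (φ : V →L[ℝ] V) (ξ : V) (η : V →L[ℝ] ℝ) (g : V →L[ℝ] V →L[ℝ] ℝ) : Prop where
  phi_xi : φ ξ = 0
  phi_phi : ∀ x, φ (φ x) = -x + η x • ξ
  eta_phi : ∀ x, η (φ x) = 0
  eta_xi : η ξ = 1
  symm : ∀ x y, g x y = g y x
  nondegenerate : ∀ x, (∀ y, g x y = 0) → x = 0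
  g_xi : ∀ x, g x ξ = η x
  g_phi_left : ∀ x y, g (φ x) y = g x (φ y)

/-- The linear conditions that single out the torsion of the `φ`-canonical connection among the
torsions of the connections preserving the structure. -/
structure IsCanonicalTorsion {V : Type*} [AddCommGroup V] [Module ℝ V] [TopologicalSpace V]
    (φ : V →L[ℝ] V) (ξ : V) (η : V →L[ℝ] ℝ) (g : V →L[ℝ] V →L[ℝ] ℝ) (T : V → V → V) : Prop where
  mixed : ∀ x y z, η x = 0 → η y = 0 → η z = 0 →
    g (T x y + φ (T (φ x) y) - φ (T x (φ y)) + T (φ x) (φ y)) z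
      = g (T x z + φ (T (φ x) z) - φ (T x (φ z)) + T (φ x) (φ z)) y
  holomorphic : ∀ x y, η x = 0 → η y = 0 →
    φ (T x y - φ (T (φ x) y) - φ (T x (φ y)) - T (φ x) (φ y)) = 0
  vertical : ∀ y z, η y = 0 → η z = 0 →
    g (T ξ y) z - g (T ξ (φ y)) (φ z) = g (T ξ z) y - g (T ξ (φ z)) (φ y)

/-- The covariant derivatives `C x y = (∇_x φ)y` and `A x = ∇_x ξ` at a point, and the difference
`Q` of the `φ`-canonical connection and the Levi-Civita connection. -/
structure IsCanonicalDifference {V : Type*} [AddCommGroup V] [Module ℝ V] [TopologicalSpace V]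
    (φ : V →L[ℝ] V) (ξ : V) (η : V →L[ℝ] ℝ) (g : V →L[ℝ] V →L[ℝ] ℝ)
    (C : V →ₗ[ℝ] V →ₗ[ℝ] V) (A : V →L[ℝ] V) (N Q : V → V → V) : Prop where
  symm : ∀ x y z, g (C x y) z = g (C x z) y
  phi : ∀ x y, C x (φ y) = -φ (C x y) + g (A x) y • ξ + η y • A x
  xi : ∀ x, C x ξ = -φ (A x)
  eta_A : ∀ x, η (A x) = 0
  nijenhuis : ∀ x y, N x y = C (φ x) y - C (φ y) x - φ (C x y) + φ (C y x)
    + (g (A x) y - g (A y) x) • ξ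
  difference : ∀ x y z, g (Q x y) z
    = g ((1 / 2 : ℝ) • (C x (φ y) + g (A x) y • ξ) - η y • A x) z
      - (1 / 8 : ℝ) * (g (N (φ (φ z)) (φ (φ y))) (φ (φ x)) + 2 * g (N (φ z) (φ y)) ξ * η x)

/-! ### Algebra of the difference between the φ-canonical and Levi-Civita connections. -/

namespace IsCanonicalDifference

variable {V : Type*} [AddCommGroup V] [Module ℝ V] [TopologicalSpace V]
  {φ : V →L[ℝ] V} {ξ : V} {η : V →L[ℝ] ℝ} {g : V →L[ℝ] V →L[ℝ] ℝ}
  {C : V →ₗ[ℝ] V →ₗ[ℝ] V} {A : V →L[ℝ] V} {N Q : V → V → V}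

theorem eta_C (hS : IsBMetricSpace φ ξ η g) (h : IsCanonicalDifference φ ξ η g C A N Q)
    (x y : V) : η (C x y) = -g (A x) (φ y) := by
  rw [← hS.g_xi, h.symm, h.xi, map_neg, neg_apply, hS.g_phi_left]

theorem nijenhuis_xi (hS : IsBMetricSpace φ ξ η g) (h : IsCanonicalDifference φ ξ η g C A N Q)
    (x y : V) : g (N x y) ξ = g (A x) y - g (A y) x - g (A (φ x)) (φ y) + g (A (φ y)) (φ x) := by
  rw [hS.g_xi, h.nijenhuis]
  simp only [map_add, map_sub, map_smul, hS.eta_phi, h.eta_C hS, hS.eta_xi, smul_eq_mul]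
  ring

/-- `Q` on vectors with horizontal last two arguments, in terms of `C` and `A` only. -/
theorem horizontal_apply (hS : IsBMetricSpace φ ξ η g)
    (h : IsCanonicalDifference φ ξ η g C A N Q) (x y z : V) (hx : η x = 0) (hy : η y = 0)
    (hz : η z = 0) :
    g (Q x y) z = -(1 / 2) * g (C x y) (φ z)
      + (1 / 8) * (g (C (φ z) y) x - g (C (φ y) z) x - g (C z y) (φ x) + g (C y z) (φ x)) := by
  have e : ∀ a, η a = 0 → φ (φ a) = -a := fun a ha ↦ by rw [hS.phi_phi, ha]; simp
  rw [h.difference, e x hx, e y hy, e z hz, hx, h.nijenhuis, h.phi, hy]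
  simp only [map_add, map_sub, map_smul, map_neg, LinearMap.neg_apply, add_apply, sub_apply, smul_apply,
    neg_apply, hS.g_phi_left, smul_eq_mul, hS.symm ξ, hS.g_xi, hx, hz]
  ring

theorem phiB_apply (hS : IsBMetricSpace φ ξ η g) (h : IsCanonicalDifference φ ξ η g C A N Q)
    (x y z : V) :
    g ((1 / 2 : ℝ) • (C x (φ y) + g (A x) y • ξ) - η y • A x) z
      = -(1 / 2) * g (C x y) (φ z) + g (A x) y * η z - 1 / 2 * (η y * g (A x) z) := by
  rw [h.phi]
  simp only [map_add, map_sub, map_smul, map_neg, add_apply, sub_apply, smul_apply,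
    neg_apply, hS.g_phi_left, smul_eq_mul, hS.symm ξ, hS.g_xi]
  ring

theorem difference_apply (hS : IsBMetricSpace φ ξ η g)
    (h : IsCanonicalDifference φ ξ η g C A N Q) (x y z : V) :
    g (Q x y) z = -(1 / 2) * g (C x y) (φ z) + g (A x) y * η z - 1 / 2 * (η y * g (A x) z)
      - (1 / 8 : ℝ) * (g (N (φ (φ z)) (φ (φ y))) (φ (φ x)) + 2 * g (N (φ z) (φ y)) ξ * η x) := by
  rw [h.difference, h.phiB_apply hS]

/-- On ker η, `C x` is g-symmetric and anticommutes with the g-symmetric φ up to terms that these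
arguments kill. -/
theorem symm_phi (hS : IsBMetricSpace φ ξ η g) (h : IsCanonicalDifference φ ξ η g C A N Q)
    {y z : V} (hy : η y = 0) (hz : η z = 0) (x : V) :
    g (C x y) (φ z) = -g (C x z) (φ y) := by
  rw [h.symm, h.phi, hz]
  simp [hS.g_phi_left, hS.symm ξ, hS.g_xi, hy]

theorem nijenhuis_skew (h : IsCanonicalDifference φ ξ η g C A N Q) (x y : V) :
    N x y = -N y x := by
  rw [h.nijenhuis, h.nijenhuis]
  module

/-- In the expansion of N through `C`, anticommutation with φ matches the terms of both sides. This
lets φ pass between the two slots of the correction term in `phi_apply`. -/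
theorem nijenhuis_phi_left (hS : IsBMetricSpace φ ξ η g)
    (h : IsCanonicalDifference φ ξ η g C A N Q) (x y : V) (hx : η x = 0) (hy : η y = 0) :
    N (φ x) y = N x (φ y) := by
  rw [h.nijenhuis, h.nijenhuis, hS.phi_phi x, hS.phi_phi y, hx, hy]
  simp only [zero_smul, add_zero, LinearMap.neg_apply, h.phi, hx, hy, map_add, map_neg, map_smul,
    hS.phi_xi, hS.phi_phi, h.eta_C hS, smul_zero]
  module

/-- The Nijenhuis terms drop out because φξ = 0. This is the statement that the connection ∇ + Q
annihilates ξ. -/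
theorem apply_xi (hS : IsBMetricSpace φ ξ η g) (h : IsCanonicalDifference φ ξ η g C A N Q)
    (x : V) : Q x ξ = -A x := by
  rw [← sub_eq_zero]
  refine hS.nondegenerate _ fun z ↦ ?_
  have hN : ∀ x, N x 0 = 0 := fun x ↦ by
    simp [h.nijenhuis]
  rw [map_sub, sub_apply, h.difference, h.phiB_apply hS, h.xi, hS.phi_xi, map_zero, hN, hN, hS.g_xi,
    h.eta_A, hS.eta_xi]
  simp [hS.g_phi_left, hS.phi_phi, hS.g_xi, h.eta_A]
  ring

theorem eta_apply (hS : IsBMetricSpace φ ξ η g) (h : IsCanonicalDifference φ ξ η g C A N Q)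
    (x y : V) : η (Q x y) = g (A x) y := by
  have hN : ∀ x, N 0 x = 0 := fun x ↦ by
    simp [h.nijenhuis]
  rw [← hS.g_xi, h.difference, h.phiB_apply hS, hS.phi_xi, map_zero, map_zero, hN, hN, hS.eta_xi,
    hS.g_xi, h.eta_A]
  simp

/-- Metricity of ∇ + Q: the correction is skew because N is skew in its first two arguments; the
rest is the symmetry of `C x` applied to φy and z. -/
theorem skew (hS : IsBMetricSpace φ ξ η g) (h : IsCanonicalDifference φ ξ η g C A N Q)
    (x y z : V) : g (Q x y) z + g y (Q x z) = 0 := by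
  rw [hS.symm y, h.difference, h.difference, h.phiB_apply hS, h.phiB_apply hS,
    h.nijenhuis_skew (φ (φ z)), h.nijenhuis_skew (φ z)]
  have e := h.symm x (φ y) z
  rw [h.phi] at e
  simp only [map_add, map_smul, map_neg, add_apply, smul_apply,
    neg_apply, hS.g_phi_left, smul_eq_mul, hS.symm ξ, hS.g_xi] at e ⊢
  linear_combination (1 / 2) * e

/-- `∇ + Q` preserves `φ`. -/
theorem phi_apply (hS : IsBMetricSpace φ ξ η g) (h : IsCanonicalDifference φ ξ η g C A N Q)
    (x y : V) : C x y + Q x (φ y) = φ (Q x y) := by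
  rw [← sub_eq_zero]
  refine hS.nondegenerate _ fun z ↦ ?_
  have e1 : N (φ (φ z)) (φ (φ (φ y))) = N (φ (φ (φ z))) (φ (φ y)) :=
    (h.nijenhuis_phi_left hS _ _ (hS.eta_phi _) (hS.eta_phi _)).symm
  have e2 : N (φ z) (φ (φ y)) = N (φ (φ z)) (φ y) :=
    (h.nijenhuis_phi_left hS _ _ (hS.eta_phi _) (hS.eta_phi _)).symm
  rw [map_sub, map_add, sub_apply, add_apply, hS.g_phi_left, h.difference, h.difference, e1, e2,
    h.phiB_apply hS, h.phiB_apply hS, h.phi]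
  simp only [map_add, map_smul, map_neg, add_apply, smul_apply, hS.phi_phi,
    neg_apply, hS.g_phi_left, smul_eq_mul, hS.symm ξ, hS.g_xi, hS.phi_xi, map_zero, hS.eta_phi, h.eta_C hS]
  ring

/-- As ∇ is torsion-free, the antisymmetrization of `Q` is the torsion. Written through `C` and `A`,
each condition reduces to a linear consequence of the symmetry of `C x` and the skewness in
`symm_phi`. -/
theorem isCanonicalTorsion (hS : IsBMetricSpace φ ξ η g)
    (h : IsCanonicalDifference φ ξ η g C A N Q) :
    IsCanonicalTorsion φ ξ η g fun x y ↦ Q x y - Q y x where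
  mixed x y z hx hy hz := by
    have e : ∀ a, η a = 0 → φ (φ a) = -a := fun a ha ↦ by rw [hS.phi_phi, ha]; simp
    have hQ := h.horizontal_apply hS
    simp only [map_add, map_sub, add_apply, sub_apply, hS.g_phi_left, hQ, hx, hy, hz, hS.eta_phi,
      e, h.phi, map_neg, neg_apply, map_smul, smul_apply, smul_eq_mul, zero_smul, LinearMap.neg_apply,
      hS.symm ξ, hS.g_xi, hS.phi_xi, map_zero, zero_apply]
    linarith [h.symm x y z, h.symm y x z, h.symm z x y, h.symm (φ x) y z, h.symm (φ y) x z,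
      h.symm (φ z) x y, h.symm_phi hS hx hy z, h.symm_phi hS hx hz y, h.symm_phi hS hy hz x]
  holomorphic x y hx hy := by
    have e : ∀ a, η a = 0 → φ (φ a) = -a := fun a ha ↦ by rw [hS.phi_phi, ha]; simp
    refine hS.nondegenerate _ fun w ↦ ?_
    -- The outer φ, moved onto the test vector, makes that vector horizontal, so `horizontal_apply`
    -- suffices.
    have hQ : ∀ x y, η x = 0 → η y = 0 → _ := fun x y hx hy ↦
      h.horizontal_apply hS x y (φ w) hx hy (hS.eta_phi w)
    have hQ' : ∀ x y, η x = 0 → η y = 0 → _ := fun x y hx hy ↦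
      h.horizontal_apply hS x y (φ (φ w)) hx hy (hS.eta_phi _)
    generalize hz : φ w = z at *
    have hz0 : η z = 0 := hz ▸ hS.eta_phi w
    simp only [map_add, map_sub, add_apply, sub_apply, hS.g_phi_left, hz, hQ, hQ', hx, hy, hz0,
      hS.eta_phi, e, h.phi, map_neg, neg_apply, map_smul, smul_apply, smul_eq_mul, zero_smul,
      LinearMap.neg_apply, hS.symm ξ, hS.g_xi, hS.phi_xi, map_zero, zero_apply]
    linarith [h.symm x y z, h.symm y x z, h.symm z x y, h.symm (φ x) y z, h.symm (φ y) x z,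
      h.symm (φ z) x y, h.symm_phi hS hx hy z, h.symm_phi hS hx hz0 y, h.symm_phi hS hy hz0 x]
  vertical y z hy hz := by
    have e : ∀ a, η a = 0 → φ (φ a) = -a := fun a ha ↦ by rw [hS.phi_phi, ha]; simp
    simp only [h.apply_xi hS, h.difference_apply hS, map_sub, sub_apply, map_neg,
      neg_apply, h.phi, hy, hz, hS.eta_phi, hS.phi_xi, e, h.nijenhuis_xi hS, hS.eta_xi]
    simp only [map_add, map_smul, map_neg, add_apply, smul_apply,
      neg_apply, hS.g_phi_left, smul_eq_mul, hS.symm ξ, hS.g_xi, map_zero,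
      hy, hz]
    linarith [h.symm ξ y z, h.symm_phi hS hy hz ξ]

end IsCanonicalDifference

/-! ### Conformal invariance of the conditions and the pointwise equivalence. -/

section

variable {V : Type*} [AddCommGroup V] [Module ℝ V] [TopologicalSpace V]
  {φ : V →L[ℝ] V} {ξ : V} {η : V →L[ℝ] ℝ} {g : V →L[ℝ] V →L[ℝ] ℝ}

namespace IsBMetricSpace

theorem phi_phi_of_eta_eq_zero (hS : IsBMetricSpace φ ξ η g) {x : V} (hx : η x = 0) :
    φ (φ x) = -x := by
  rw [hS.phi_phi, hx, zero_smul, add_zero]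

theorem eq_zero_of_horizontal (hS : IsBMetricSpace φ ξ η g) {x : V} (hx : η x = 0)
    (h : ∀ z, η z = 0 → g x z = 0) : x = 0 := by
  refine hS.nondegenerate x fun w ↦ ?_
  have := h (w - η w • ξ) (by simp [hS.eta_xi])
  simpa [hS.g_xi, hx] using this

/-- φ is a complex structure on ker η, so `a + bi` acts injectively unless it is zero; multiplying
by the conjugate shows this. -/
theorem smul_add_smul_phi_eq_zero (hS : IsBMetricSpace φ ξ η g) {x : V} (hx : η x = 0)
    (hx0 : x ≠ 0) {a b : ℝ} (h : a • x + b • φ x = 0) : a = 0 ∧ b = 0 := by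
  have h1 : a • φ x - b • x = 0 := by
    have := congrArg φ h
    simpa [hS.phi_phi_of_eta_eq_zero hx, sub_eq_add_neg] using this
  have h2 : (a ^ 2 + b ^ 2) • x = a • (a • x + b • φ x) - b • (a • φ x - b • x) := by module
  rw [h, h1, smul_zero, smul_zero, sub_zero, smul_eq_zero] at h2
  have h3 := h2.resolve_right hx0
  constructor <;> nlinarith

end IsBMetricSpace

/-- The conditions on the torsion are invariant under conformal changes of the structure. -/
theorem IsCanonicalTorsion.conformal (hS : IsBMetricSpace φ ξ η g) {T : V →ₗ[ℝ] V →ₗ[ℝ] V}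
    (h : IsCanonicalTorsion φ ξ η g fun x y ↦ T x y) {g' : V →L[ℝ] V →L[ℝ] ℝ} {η' : V →L[ℝ] ℝ}
    {ξ' : V} {a b c d e : ℝ} (hξ : ξ' = d • ξ) (hη : ∀ x, η' x = e * η x) (he : e ≠ 0)
    (hg : ∀ x y, g' x y = a * g x y + b * g x (φ y) + c * (η x * η y)) :
    IsCanonicalTorsion φ ξ' η' g' fun x y ↦ T x y := by
  have hη' : ∀ {x}, η' x = 0 → η x = 0 := fun {x} hx ↦ by
    rw [hη] at hx
    exact (mul_eq_zero.1 hx).resolve_left he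
  have hφ : ∀ x, η x = 0 → φ (φ x) = -x := fun x hx ↦ hS.phi_phi_of_eta_eq_zero hx
  refine ⟨fun x y z hx hy hz ↦ ?_, fun x y hx hy ↦ h.holomorphic x y (hη' hx) (hη' hy),
    fun y z hy hz ↦ ?_⟩
  · have hx := hη' hx
    have hy := hη' hy
    have hz := hη' hz
    have h1 := h.mixed x y z hx hy hz
    -- The new metric mixes `g` with `g(·, φ·)`. The expression in `mixed` is complex linear in its
    -- second slot, so testing at φz supplies the `b` part.
    have h2 := h.mixed x y (φ z) hx hy (hS.eta_phi z)
    simp only [hg, map_add, map_sub, add_apply, sub_apply, hS.g_phi_left, hφ, hy, hz, map_neg,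
      neg_apply] at h1 h2 ⊢
    linear_combination a * h1 + b * h2
  · have hy := hη' hy
    have hz := hη' hz
    have h1 := h.vertical y z hy hz
    have h2 := h.vertical y (φ z) hy (hS.eta_phi z)
    simp only [hg, hξ, map_smul, LinearMap.smul_apply, smul_apply, hφ, hy, hz, map_neg,
      neg_apply, hS.eta_phi, smul_eq_mul] at h1 h2 ⊢
    linear_combination d * a * h1 + d * b * h2

theorem IsCanonicalTorsion.sub {T T' : V → V → V} (h : IsCanonicalTorsion φ ξ η g T)
    (h' : IsCanonicalTorsion φ ξ η g T') :
    IsCanonicalTorsion φ ξ η g fun x y ↦ T x y - T' x y := by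
  refine ⟨fun x y z hx hy hz ↦ ?_, fun x y hx hy ↦ ?_, fun y z hy hz ↦ ?_⟩
  · have h1 := h.mixed x y z hx hy hz
    have h2 := h'.mixed x y z hx hy hz
    simp only [map_add, map_sub, add_apply, sub_apply] at h1 h2 ⊢
    linear_combination h1 - h2
  · have h1 := h.holomorphic x y hx hy
    have h2 := h'.holomorphic x y hx hy
    have e := congrArg₂ (· - ·) h1 h2
    simp only [map_sub, sub_zero] at e ⊢
    rw [← e]
    abel
  · have h1 := h.vertical y z hy hz
    have h2 := h'.vertical y z hy hz
    simp only [map_sub, sub_apply] at h1 h2 ⊢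
    linear_combination h1 - h2

/-- Two connections preserving conformally related structures whose torsions are canonical have the
same torsion if and only if the conformal factor is holomorphic along `ker η` and constant along
`ξ`, and the change of `ξ` is constant along `ker η`. -/
theorem symmetric_difference_iff (hS : IsBMetricSpace φ ξ η g) {s : V →ₗ[ℝ] V →ₗ[ℝ] V}
    {du dv dw : V →L[ℝ] ℝ} (hφ : ∀ x y, s x (φ y) = φ (s x y)) (hξ : ∀ x, s x ξ = dw x • ξ)
    (hη : ∀ x y, η (s x y) = dw x * η y)
    (hg : ∀ x y z, η y = 0 → η z = 0 →
      g (s x y) z + g y (s x z) = 2 * (du x * g y z + dv x * g y (φ z)))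
    (hT : IsCanonicalTorsion φ ξ η g fun x y ↦ s x y - s y x) {h : V} (hh : η h = 0)
    (hh0 : h ≠ 0) :
    (∀ x y, s x y = s y x) ↔
      (∀ x, du (φ (φ x)) + dv (φ x) = 0) ∧ (∀ x, du (φ x) - dv (φ (φ x)) = 0) ∧
        du ξ = 0 ∧ dv ξ = 0 ∧ ∀ x, dw (φ x) = 0 := by
  have hpp : ∀ x, η x = 0 → φ (φ x) = -x := fun x hx ↦ hS.phi_phi_of_eta_eq_zero hx
  have hη0 : ∀ x y, η y = 0 → η (s x y) = 0 := fun x y hy ↦ by rw [hη, hy, mul_zero]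
  -- The left side is twice the part of `s` antilinear in x. In the `mixed` expression `s y x`
  -- contributes nothing, being linear in x; the resulting symmetry in y and z, with the
  -- symmetrization `hg`, determines this part.
  have key : ∀ x y, η x = 0 → η y = 0 →
      s x y + φ (s (φ x) y) = (du x - dv (φ x)) • y + (dv x + du (φ x)) • φ y := by
    intro x y hx hy
    rw [← sub_eq_zero]
    refine hS.eq_zero_of_horizontal ?_ fun z hz ↦ ?_
    · simp [hη0 x y hy, hS.eta_phi, hy]
    · have h1 := hT.mixed x y z hx hy hz
      have h2 := hg x y z hy hz
      have h3 := hg (φ x) y (φ z) hy (hS.eta_phi z)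
      rw [hS.symm y] at h2 h3
      simp only [hφ, hpp _ hz, hpp _ (hη0 _ _ hx), hpp _ (hη0 _ _ hy),
        hpp _ (hη0 _ _ hz), map_add, map_sub, map_neg, map_smul, add_apply, sub_apply, neg_apply,
        smul_apply, smul_eq_mul, hS.g_phi_left] at h1 h2 h3 ⊢
      linarith
  -- Same mechanism: `vertical` makes `g (s ξ y) z` symmetric on ker η, and `hg` gives its
  -- symmetrization.
  have keyξ : ∀ y, η y = 0 → s ξ y = du ξ • y + dv ξ • φ y := by
    intro y hy
    rw [← sub_eq_zero]
    refine hS.eq_zero_of_horizontal ?_ fun z hz ↦ ?_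
    · simp [hη0 ξ y hy, hS.eta_phi, hy]
    · have h1 := hT.vertical y z hy hz
      have h2 := hg ξ y z hy hz
      rw [hS.symm y] at h2
      simp only [hφ, hξ, hpp _ hz, hpp _ hy, map_add, map_sub, map_neg, map_smul, add_apply,
        sub_apply, smul_apply, smul_eq_mul, hS.g_phi_left, hS.symm ξ, hS.g_xi, hy, hz,
        hS.phi_xi, map_zero] at h1 h2 ⊢
      linarith
  constructor
  · intro hs
    have hw : ∀ y, η y = 0 → dw y = 0 := fun y hy ↦ by
      have := hη ξ y
      rwa [hs, hξ, hy, map_smul, hS.eta_xi, smul_eq_mul, mul_one, mul_zero] at this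
    have hξ0 := keyξ h hh
    rw [hs, hξ, hw h hh, zero_smul] at hξ0
    obtain ⟨hu, hv⟩ := hS.smul_add_smul_phi_eq_zero hh hh0 hξ0.symm
    have hx : ∀ x, η x = 0 → du x - dv (φ x) = 0 ∧ dv x + du (φ x) = 0 := fun x hx ↦ by
      have := key x h hx hh
      -- Symmetry transfers φ-linearity from the second slot to the first, so the antilinear part
      -- vanishes.
      rw [hs (φ x), hφ, hs h x, hpp _ (hη0 x h hh), add_neg_cancel] at this
      exact hS.smul_add_smul_phi_eq_zero hh hh0 this.symm
    refine ⟨fun x ↦ ?_, fun x ↦ (hx _ (hS.eta_phi x)).1, hu, hv, fun x ↦ hw _ (hS.eta_phi x)⟩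
    rw [add_comm]
    exact (hx _ (hS.eta_phi x)).2
  · rintro ⟨h1, h2, hu, hv, hw⟩
    have hw' : ∀ y, η y = 0 → dw y = 0 := fun y hy ↦ by
      have := hw (φ y)
      rwa [hpp _ hy, map_neg, neg_eq_zero] at this
    -- The Cauchy–Riemann conditions kill the antilinear part, so `s` is complex bilinear on ker η.
    have hsφ : ∀ x y, η x = 0 → η y = 0 → s (φ x) y = φ (s x y) := fun x y hx hy ↦ by
      have e := key x y hx hy
      have e1 := h1 x
      have e2 := h2 x
      rw [hpp _ hx, map_neg] at e1 e2
      rw [show du x - dv (φ x) = 0 by linarith, show dv x + du (φ x) = 0 by linarith, zero_smul,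
        zero_smul, add_zero] at e
      have := congrArg φ e
      rw [map_add, hpp _ (hη0 _ _ hy), map_zero] at this
      exact (eq_of_sub_eq_zero (by rwa [sub_eq_add_neg])).symm
    have hH : ∀ x y, η x = 0 → η y = 0 → s x y = s y x := fun x y hx hy ↦ by
      -- For a complex bilinear `s` the bracket in `holomorphic` is four times the
      -- antisymmetrization of `s`; a second φ undoes the first up to sign.
      have e := congrArg φ (hT.holomorphic x y hx hy)
      simp only [hφ, hsφ x y hx hy, hsφ y x hy hx, 
        map_sub, map_zero, hpp _ (hη0 _ _ hx),
        hpp _ (hη0 _ _ hy), map_neg] at e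
      have e' : (4 : ℝ) • (s x y - s y x) = 0 := by
        rw [← neg_eq_zero, ← e]
        module
      exact sub_eq_zero.1 ((smul_eq_zero.1 e').resolve_left (by norm_num))
    have hξH : ∀ y, η y = 0 → s ξ y = s y ξ := fun y hy ↦ by
      rw [keyξ y hy, hξ, hw' y hy, hu, hv]
      simp
    intro x y
    obtain ⟨x', a, hx', rfl⟩ : ∃ x' t, η x' = 0 ∧ x = x' + t • ξ :=
      ⟨x - η x • ξ, η x, by simp [hS.eta_xi], by simp⟩
    obtain ⟨y', b, hy', rfl⟩ : ∃ y' t, η y' = 0 ∧ y = y' + t • ξ :=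
      ⟨y - η y • ξ, η y, by simp [hS.eta_xi], by simp⟩
    simp only [map_add, map_smul, LinearMap.add_apply, LinearMap.smul_apply, hH x' y' hx' hy',
      hξH y' hy', hξH x' hx']
    module

end

/-! ### From vector fields to tensors at a point. -/

namespace AlmostContactBMetric

section

variable {E : Type*} [NormedAddCommGroup E] [NormedSpace ℝ E]
  {M : Type*} [TopologicalSpace M] [ChartedSpace E M] [IsManifold 𝓘(ℝ, E) ∞ M]

theorem isBMetricSpace (S : AlmostContactBMetric E M) (p : M) :
    IsBMetricSpace (S.phi p) (S.xi p) (S.eta p) (S.g p) :=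
  ⟨S.phi_xi p, S.phi_phi p, S.eta_phi p, S.eta_xi p, S.g_symm p, S.g_nondegenerate p, S.g_xi p,
    S.g_phi_left p⟩

variable {p : M} {X Y Z : Π q : M, TangentSpace 𝓘(ℝ, E) q}

theorem mdifferentiableAt_xi (S : AlmostContactBMetric E M) : MDiffAt (T% S.xi) p :=
  S.smooth_xi.mdifferentiableAt (by simp)

theorem mdifferentiableAt_phiField (S : AlmostContactBMetric E M) (hX : MDiffAt (T% X) p) :
    MDiffAt (T% (S.phiField X)) p :=
  (S.smooth_phi.mdifferentiableAt (by simp)).clm_bundle_apply (b := id) hX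

theorem mdifferentiableAt_g (S : AlmostContactBMetric E M) (hX : MDiffAt (T% X) p)
    (hY : MDiffAt (T% Y) p) : MDiffAt (fun q ↦ S.g q (X q) (Y q)) p := by
  have h := (S.smooth_g.mdifferentiableAt (x := p) (by simp)).clm_bundle_apply₂
    (E₃ := Bundle.Trivial M ℝ) (F₃ := ℝ) (b := id) hX hY
  simp only [mdifferentiableAt_totalSpace] at h
  exact h.2

theorem mdifferentiableAt_eta (S : AlmostContactBMetric E M) (hX : MDiffAt (T% X) p) :
    MDiffAt (fun q ↦ S.eta q (X q)) p := by
  simpa only [S.g_xi] using S.mdifferentiableAt_g hX S.mdifferentiableAt_xi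

variable [CompleteSpace E] [FiniteDimensional ℝ E]
  {nabla : CovariantDerivative 𝓘(ℝ, E) E (TangentSpace 𝓘(ℝ, E) : M → Type _)}

/-- The two Leibniz terms, both `df ⊗ φY`, cancel. -/
theorem tensorialAt_covPhi (S : AlmostContactBMetric E M)
    (nabla : CovariantDerivative 𝓘(ℝ, E) E (TangentSpace 𝓘(ℝ, E) : M → Type _)) (p : M) :
    TensorialAt 𝓘(ℝ, E) E (fun Y : Π q : M, TangentSpace 𝓘(ℝ, E) q ↦
      nabla (S.phiField Y) p - (S.phi p).comp (nabla Y p)) p where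
  smul {f Y} hf hY := by
    have e : S.phiField (f • Y) = f • S.phiField Y := by
      ext q
      simp [phiField]
    ext x
    rw [e, nabla.isCovariantDerivativeOn.leibniz (S.mdifferentiableAt_phiField hY) hf,
      nabla.isCovariantDerivativeOn.leibniz hY hf]
    simp [phiField]
    module
  add {Y Z} hY hZ := by
    have e : S.phiField (Y + Z) = S.phiField Y + S.phiField Z := by
      ext q
      simp [phiField]
    ext x
    rw [e, nabla.isCovariantDerivativeOn.add (S.mdifferentiableAt_phiField hY)
      (S.mdifferentiableAt_phiField hZ), nabla.isCovariantDerivativeOn.add hY hZ]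
    simp
    module

/-- The tensor `C x y = (∇_x φ)y` at a point. -/
noncomputable def covPhiTensor (S : AlmostContactBMetric E M)
    (nabla : CovariantDerivative 𝓘(ℝ, E) E (TangentSpace 𝓘(ℝ, E) : M → Type _)) (p : M) :
    TangentSpace 𝓘(ℝ, E) p →ₗ[ℝ] TangentSpace 𝓘(ℝ, E) p →ₗ[ℝ] TangentSpace 𝓘(ℝ, E) p :=
  LinearMap.mk₂ ℝ (fun x y ↦ TensorialAt.mkHom _ p (S.tensorialAt_covPhi nabla p) y x)
    (by simp) (by simp) (by simp) (by simp)

theorem covPhiTensor_apply (S : AlmostContactBMetric E M) (hY : MDiffAt (T% Y) p)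
    (x : TangentSpace 𝓘(ℝ, E) p) :
    S.covPhiTensor nabla p x (Y p) = nabla (S.phiField Y) p x - S.phi p (nabla Y p x) := by
  simp only [covPhiTensor, LinearMap.mk₂_apply]
  rw [TensorialAt.mkHom_apply _ hY]
  rfl

/-- Every tangent vector is the value of a differentiable vector field. -/
theorem exists_field (x : TangentSpace 𝓘(ℝ, E) p) :
    ∃ X : Π q : M, TangentSpace 𝓘(ℝ, E) q, MDiffAt (T% X) p ∧ X p = x :=
  ⟨FiberBundle.extend E x, FiberBundle.mdifferentiableAt_extend .., by simp⟩

theorem difference_apply {D : CovariantDerivative 𝓘(ℝ, E) E (TangentSpace 𝓘(ℝ, E) : M → Type _)}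
    (hY : MDiffAt (T% Y) p) : D.difference nabla p (Y p) = D Y p - nabla Y p :=
  IsCovariantDerivativeOn.difference_apply _ _ (hσ := hY)

namespace IsLeviCivita

variable {S : AlmostContactBMetric E M}

theorem mvfderiv_g (h : S.IsLeviCivita nabla) (hY : MDiffAt (T% Y) p) (hZ : MDiffAt (T% Z) p)
    (x : TangentSpace 𝓘(ℝ, E) p) :
    mvfderiv 𝓘(ℝ, E) (fun q ↦ S.g q (Y q) (Z q)) p x
      = S.g p (nabla Y p x) (Z p) + S.g p (Y p) (nabla Z p x) := by
  obtain ⟨X, -, rfl⟩ := exists_field x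
  exact h.2 p X Y Z hY hZ

/-- η is the metric dual of ξ, so this is metricity with ξ in the second slot. -/
theorem mvfderiv_eta (h : S.IsLeviCivita nabla) (hY : MDiffAt (T% Y) p)
    (x : TangentSpace 𝓘(ℝ, E) p) :
    mvfderiv 𝓘(ℝ, E) (fun q ↦ S.eta q (Y q)) p x
      = S.eta p (nabla Y p x) + S.g p (nabla S.xi p x) (Y p) := by
  have := h.mvfderiv_g hY S.mdifferentiableAt_xi x
  simp only [S.g_xi] at this
  rw [this, S.g_symm p (Y p)]

theorem covEta_eq (h : S.IsLeviCivita nabla) (hY : MDiffAt (T% Y) p) :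
    S.covEta nabla X Y p = S.g p (nabla S.xi p (X p)) (Y p) := by
  rw [covEta, h.mvfderiv_eta hY, add_sub_cancel_left]

theorem mlieBracket_eq (h : S.IsLeviCivita nabla) (hX : MDiffAt (T% X) p)
    (hY : MDiffAt (T% Y) p) :
    VectorField.mlieBracket 𝓘(ℝ, E) X Y p = nabla Y p (X p) - nabla X p (Y p) :=
  ((nabla.torsion_eq_zero_iff.1 h.1) hX hY).symm

theorem nijenhuis_eq (h : S.IsLeviCivita nabla) (hX : MDiffAt (T% X) p) (hY : MDiffAt (T% Y) p) :
    S.nijenhuis X Y p = S.covPhiTensor nabla p (S.phi p (X p)) (Y p)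
      - S.covPhiTensor nabla p (S.phi p (Y p)) (X p)
      - S.phi p (S.covPhiTensor nabla p (X p) (Y p)) + S.phi p (S.covPhiTensor nabla p (Y p) (X p))
      + (S.g p (nabla S.xi p (X p)) (Y p) - S.g p (nabla S.xi p (Y p)) (X p)) • S.xi p := by
  have hX' := S.mdifferentiableAt_phiField hX
  have hY' := S.mdifferentiableAt_phiField hY
  simp only [nijenhuis, dEta, h.mlieBracket_eq hX hY, h.mlieBracket_eq hX' hY,
    h.mlieBracket_eq hX hY', h.mlieBracket_eq hX' hY', h.mvfderiv_eta hX, h.mvfderiv_eta hY,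
    S.covPhiTensor_apply hX, S.covPhiTensor_apply hY, map_sub]
  simp only [phiField]
  module

/-- The fields are the covariant derivatives of the structure identities: self-adjointness of φ, φ²
= -Id + η ⊗ ξ, φξ = 0 and η(ξ) = 1. -/
theorem isCanonicalDifference (h : S.IsLeviCivita nabla)
    {D : CovariantDerivative 𝓘(ℝ, E) E (TangentSpace 𝓘(ℝ, E) : M → Type _)}
    (hD : ∀ (p : M) (X Y Z : Π q : M, TangentSpace 𝓘(ℝ, E) q),
      MDiffAt (T% X) p → MDiffAt (T% Y) p → MDiffAt (T% Z) p →
      S.g p (D Y p (X p)) (Z p)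
        = S.g p (nabla Y p (X p)) (Z p) + S.phiCanonicalDifference nabla X Y Z p) (p : M) :
    IsCanonicalDifference (S.phi p) (S.xi p) (S.eta p) (S.g p) (S.covPhiTensor nabla p)
      (nabla S.xi p)
      (fun x y ↦ S.covPhiTensor nabla p (S.phi p x) y - S.covPhiTensor nabla p (S.phi p y) x
        - S.phi p (S.covPhiTensor nabla p x y) + S.phi p (S.covPhiTensor nabla p y x)
        + (S.g p (nabla S.xi p x) y - S.g p (nabla S.xi p y) x) • S.xi p)
      (fun x y ↦ D.difference nabla p y x) where
  symm x y z := by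
    obtain ⟨Y, hY, rfl⟩ := exists_field y
    obtain ⟨Z, hZ, rfl⟩ := exists_field z
    have h1 := h.mvfderiv_g (S.mdifferentiableAt_phiField hY) hZ x
    have h2 := h.mvfderiv_g hY (S.mdifferentiableAt_phiField hZ) x
    have e : (fun q ↦ S.g q (S.phiField Y q) (Z q)) = fun q ↦ S.g q (Y q) (S.phiField Z q) :=
      funext fun q ↦ S.g_phi_left q (Y q) (Z q)
    rw [e, h2] at h1
    rw [S.covPhiTensor_apply hY, S.covPhiTensor_apply hZ, S.g_symm p _ (Y p)]
    simp only [map_sub, sub_apply, S.g_phi_left]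
    rw [← S.g_phi_left p (Y p)]
    simp only [phiField] at h1 ⊢
    linarith
  phi x y := by
    obtain ⟨Y, hY, rfl⟩ := exists_field y
    have hY' := S.mdifferentiableAt_phiField hY
    have hη := S.mdifferentiableAt_eta hY
    have e : S.phiField (S.phiField Y) = (-1 : ℝ) • Y + (fun q ↦ S.eta q (Y q)) • S.xi := by
      ext q
      simp [phiField, S.phi_phi]
    have h1 := S.covPhiTensor_apply hY' (nabla := nabla) x
    rw [e, nabla.isCovariantDerivativeOn.add hY.smul_const_section
      (hη.smul_section S.mdifferentiableAt_xi), nabla.isCovariantDerivativeOn.smul_const _ hY,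
      nabla.isCovariantDerivativeOn.leibniz S.mdifferentiableAt_xi hη] at h1
    change S.covPhiTensor nabla p x (S.phi p (Y p)) = _ at h1
    rw [h1, S.covPhiTensor_apply hY, map_sub, S.phi_phi]
    simp only [add_apply, smul_apply, ContinuousLinearMap.smulRight_apply, h.mvfderiv_eta hY]
    module
  xi x := by
    have e : S.phiField S.xi = 0 := funext fun q ↦ S.phi_xi q
    rw [S.covPhiTensor_apply S.mdifferentiableAt_xi, e, nabla.zero]
    simp
  eta_A x := by
    have := h.mvfderiv_eta S.mdifferentiableAt_xi x
    simp only [S.eta_xi, S.g_xi, mvfderiv_const] at this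
    simp at this
    linarith
  nijenhuis _ _ := rfl
  difference x y z := by
    obtain ⟨X, hX, rfl⟩ := exists_field x
    obtain ⟨Y, hY, rfl⟩ := exists_field y
    obtain ⟨Z, hZ, rfl⟩ := exists_field z
    have hp {X : Π q : M, TangentSpace 𝓘(ℝ, E) q} (hX : MDiffAt (T% X) p) := S.mdifferentiableAt_phiField hX
    rw [difference_apply hY, sub_apply, map_sub, sub_apply, hD p X Y Z hX hY hZ, phiCanonicalDifference,
      add_sub_cancel_left, nijenhuisLow, nijenhuisLow, h.nijenhuis_eq (hp (hp hZ)) (hp (hp hY)),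
      h.nijenhuis_eq (hp hZ) (hp hY), phiBDifference, h.covEta_eq hY]
    have e := S.covPhiTensor_apply (hp hY) (nabla := nabla) (X p)
    simp only [covPhi, ← e]
    rfl

end IsLeviCivita

end

/-! ### Structure-preserving connections and their torsion. -/

section

variable {E : Type*} [NormedAddCommGroup E] [NormedSpace ℝ E]
  {M : Type*} [TopologicalSpace M] [ChartedSpace E M] [IsManifold 𝓘(ℝ, E) ∞ M]
  [CompleteSpace E] [FiniteDimensional ℝ E]
  {p : M} {X Y Z : Π q : M, TangentSpace 𝓘(ℝ, E) q}

/-- A connection preserving `φ`, `ξ`, `η` and `g`. -/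
structure IsNatural (S : AlmostContactBMetric E M)
    (D : CovariantDerivative 𝓘(ℝ, E) E (TangentSpace 𝓘(ℝ, E) : M → Type _)) : Prop where
  phi {p : M} {Y : Π q : M, TangentSpace 𝓘(ℝ, E) q} (hY : MDiffAt (T% Y) p)
    (x : TangentSpace 𝓘(ℝ, E) p) : D (S.phiField Y) p x = S.phi p (D Y p x)
  xi (p : M) (x : TangentSpace 𝓘(ℝ, E) p) : D S.xi p x = 0
  eta {p : M} {Y : Π q : M, TangentSpace 𝓘(ℝ, E) q} (hY : MDiffAt (T% Y) p)
    (x : TangentSpace 𝓘(ℝ, E) p) :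
    mvfderiv 𝓘(ℝ, E) (fun q ↦ S.eta q (Y q)) p x = S.eta p (D Y p x)
  g {p : M} {Y Z : Π q : M, TangentSpace 𝓘(ℝ, E) q} (hY : MDiffAt (T% Y) p)
    (hZ : MDiffAt (T% Z) p) (x : TangentSpace 𝓘(ℝ, E) p) :
    mvfderiv 𝓘(ℝ, E) (fun q ↦ S.g q (Y q) (Z q)) p x
      = S.g p (D Y p x) (Z p) + S.g p (Y p) (D Z p x)

variable {S : AlmostContactBMetric E M}
  {D DBar : CovariantDerivative 𝓘(ℝ, E) E (TangentSpace 𝓘(ℝ, E) : M → Type _)}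

theorem IsPhiCanonical.isNatural (h : S.IsPhiCanonical D) : S.IsNatural D := by
  obtain ⟨nabla, hn, hD⟩ := h
  have hQ := hn.isCanonicalDifference hD
  have hS := S.isBMetricSpace
  have hDY {p : M} {Y : Π q : M, TangentSpace 𝓘(ℝ, E) q} (hY : MDiffAt (T% Y) p)
      (x : TangentSpace 𝓘(ℝ, E) p) :
      D Y p x = nabla Y p x + D.difference nabla p (Y p) x := by
    rw [difference_apply hY, sub_apply, add_sub_cancel]
  refine ⟨fun {p Y} hY x ↦ ?_, fun p x ↦ ?_, fun {p Y} hY x ↦ ?_, fun {p Y Z} hY hZ x ↦ ?_⟩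
  · have h1 := (hQ p).phi_apply (hS p) x (Y p)
    rw [S.covPhiTensor_apply hY] at h1
    rw [hDY hY, map_add, ← h1, hDY (S.mdifferentiableAt_phiField hY)]
    simp only [phiField]
    module
  · rw [hDY S.mdifferentiableAt_xi, (hQ p).apply_xi (hS p), add_neg_cancel]
  · rw [hn.mvfderiv_eta hY, hDY hY, map_add, (hQ p).eta_apply (hS p)]
  · have h1 := (hQ p).skew (hS p) x (Y p) (Z p)
    rw [hn.mvfderiv_g hY hZ, hDY hY, hDY hZ]
    simp only [map_add, add_apply]
    linarith

theorem IsPhiCanonical.isCanonicalTorsion (h : S.IsPhiCanonical D) (p : M) :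
    IsCanonicalTorsion (S.phi p) (S.xi p) (S.eta p) (S.g p) fun x y ↦ D.torsion p x y := by
  obtain ⟨nabla, hn, hD⟩ := h
  convert (hn.isCanonicalDifference hD p).isCanonicalTorsion (S.isBMetricSpace p) using 3 with x y
  obtain ⟨X, hX, rfl⟩ := exists_field x
  obtain ⟨Y, hY, rfl⟩ := exists_field y
  rw [D.torsion_apply hX hY, hn.mlieBracket_eq hX hY, difference_apply hX, difference_apply hY]
  simp only [sub_apply]
  abel

theorem torsion_sub_torsion (x y : TangentSpace 𝓘(ℝ, E) p) :
    DBar.torsion p x y - D.torsion p x y = DBar.difference D p y x - DBar.difference D p x y := by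
  obtain ⟨X, hX, rfl⟩ := exists_field x
  obtain ⟨Y, hY, rfl⟩ := exists_field y
  rw [D.torsion_apply hX hY, DBar.torsion_apply hX hY, difference_apply hX, difference_apply hY]
  simp only [sub_apply]
  abel

/-! ### Effect of a conformal transformation on the connection. -/

section transform

variable {a : ConformalParam E M}

theorem mdifferentiableAt_param (f : C^∞⟮𝓘(ℝ, E), M; ℝ⟯) : MDiffAt f p :=
  f.contMDiff.mdifferentiableAt (by simp)

theorem mvfderiv_comp_real {f : M → ℝ} (hf : MDiffAt f p) {F : ℝ → ℝ} {F' : ℝ}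
    (hF : HasDerivAt F F' (f p)) (x : TangentSpace 𝓘(ℝ, E) p) :
    mvfderiv 𝓘(ℝ, E) (fun q ↦ F (f q)) p x = F' * mvfderiv 𝓘(ℝ, E) f p x := by
  have h := hF.hasFDerivAt.hasMFDerivAt.comp p hf.hasMFDerivAt
  have e : mfderiv 𝓘(ℝ, E) 𝓘(ℝ, ℝ) (fun q ↦ F (f q)) p = _ := h.mfderiv
  simp only [mvfderiv, e]
  exact mul_comm _ F'

theorem mdifferentiableAt_comp_real {f : M → ℝ} (hf : MDiffAt f p) {F : ℝ → ℝ}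
    (hF : DifferentiableAt ℝ F (f p)) : MDiffAt (fun q ↦ F (f q)) p :=
  hF.mdifferentiableAt.comp p hf

theorem mvfderiv_exp (f : C^∞⟮𝓘(ℝ, E), M; ℝ⟯) (x : TangentSpace 𝓘(ℝ, E) p) :
    mvfderiv 𝓘(ℝ, E) (fun q ↦ Real.exp (f q)) p x
      = Real.exp (f p) * mvfderiv 𝓘(ℝ, E) f p x :=
  mvfderiv_comp_real (mdifferentiableAt_param f) (Real.hasDerivAt_exp _) x

/-- With `mvfderiv_beta`: α + iβ = exp(2(u + iv)), so its logarithmic differential is 2(du + i dv).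
-/
theorem mvfderiv_alpha (x : TangentSpace 𝓘(ℝ, E) p) :
    mvfderiv 𝓘(ℝ, E) (alpha a) p x
      = 2 * (alpha a p * mvfderiv 𝓘(ℝ, E) a.1 p x - beta a p * mvfderiv 𝓘(ℝ, E) a.2.1 p x) := by
  have hu := mdifferentiableAt_param a.1 (p := p)
  have hv := mdifferentiableAt_param a.2.1 (p := p)
  have h1 := ((hasDerivAt_id (a.1 p)).const_mul 2).exp
  have h2 := ((hasDerivAt_id (a.2.1 p)).const_mul 2).cos
  have e := mvfderiv_fun_mul (mdifferentiableAt_comp_real hu h1.differentiableAt)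
    (mdifferentiableAt_comp_real hv h2.differentiableAt)
  change mvfderiv 𝓘(ℝ, E) (alpha a) p = _ at e
  rw [e, add_apply, smul_apply, smul_apply, mvfderiv_comp_real hu h1, mvfderiv_comp_real hv h2]
  simp only [alpha, beta, id, smul_eq_mul]
  ring

theorem mvfderiv_beta (x : TangentSpace 𝓘(ℝ, E) p) :
    mvfderiv 𝓘(ℝ, E) (beta a) p x
      = 2 * (beta a p * mvfderiv 𝓘(ℝ, E) a.1 p x + alpha a p * mvfderiv 𝓘(ℝ, E) a.2.1 p x) := by
  have hu := mdifferentiableAt_param a.1 (p := p)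
  have hv := mdifferentiableAt_param a.2.1 (p := p)
  have h1 := ((hasDerivAt_id (a.1 p)).const_mul 2).exp
  have h2 := ((hasDerivAt_id (a.2.1 p)).const_mul 2).sin
  have e := mvfderiv_fun_mul (mdifferentiableAt_comp_real hu h1.differentiableAt)
    (mdifferentiableAt_comp_real hv h2.differentiableAt)
  change mvfderiv 𝓘(ℝ, E) (beta a) p = _ at e
  rw [e, add_apply, smul_apply, smul_apply, mvfderiv_comp_real hu h1, mvfderiv_comp_real hv h2]
  simp only [alpha, beta, id, smul_eq_mul]
  ring

theorem difference_phi (hD : S.IsNatural D) (hDBar : (S.transform a).IsNatural DBar)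
    (x y : TangentSpace 𝓘(ℝ, E) p) :
    DBar.difference D p (S.phi p y) x = S.phi p (DBar.difference D p y x) := by
  obtain ⟨Y, hY, rfl⟩ := exists_field y
  have e := difference_apply (D := DBar) (nabla := D) (S.mdifferentiableAt_phiField hY)
  change DBar.difference D p (S.phi p (Y p)) = _ at e
  rw [e, difference_apply hY, sub_apply, sub_apply, map_sub, hD.phi hY]
  exact congrArg (· - _) (hDBar.phi hY x)

theorem difference_eta (hD : S.IsNatural D) (hDBar : (S.transform a).IsNatural DBar)
    (x y : TangentSpace 𝓘(ℝ, E) p) :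
    S.eta p (DBar.difference D p y x) = mvfderiv 𝓘(ℝ, E) a.2.2 p x * S.eta p y := by
  obtain ⟨Y, hY, rfl⟩ := exists_field y
  have h1 := hD.eta hY x
  have h2 := hDBar.eta hY x
  have hw := mdifferentiableAt_comp_real (mdifferentiableAt_param a.2.2 (p := p))
    Real.differentiableAt_exp
  have e := mvfderiv_fun_mul hw (S.mdifferentiableAt_eta hY)
  change mvfderiv 𝓘(ℝ, E) (fun q ↦ Real.exp (a.2.2 q) * S.eta q (Y q)) p x
    = Real.exp (a.2.2 p) * S.eta p (DBar Y p x) at h2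
  rw [e, add_apply, smul_apply, smul_apply, mvfderiv_exp, h1, smul_eq_mul, smul_eq_mul] at h2
  rw [difference_apply hY, sub_apply, map_sub]
  refine mul_left_cancel₀ (Real.exp_pos (a.2.2 p)).ne' ?_
  linear_combination -h2

theorem difference_xi (hD : S.IsNatural D) (hDBar : (S.transform a).IsNatural DBar)
    (x : TangentSpace 𝓘(ℝ, E) p) :
    DBar.difference D p (S.xi p) x = mvfderiv 𝓘(ℝ, E) a.2.2 p x • S.xi p := by
  -- The scaling of ξ is written as the exponential of the smooth function `-w`, so that
  -- `mvfderiv_exp` applies.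
  have hw := mdifferentiableAt_comp_real (mdifferentiableAt_param (-a.2.2) (p := p))
    Real.differentiableAt_exp
  have h2 : DBar ((fun q ↦ Real.exp ((-a.2.2 : C^∞⟮𝓘(ℝ, E), M; ℝ⟯) q)) • S.xi) p x = 0 :=
    hDBar.xi p x
  have e : mvfderiv 𝓘(ℝ, E) (-a.2.2 : C^∞⟮𝓘(ℝ, E), M; ℝ⟯) p = -mvfderiv 𝓘(ℝ, E) a.2.2 p :=
    mvfderiv_neg
  rw [DBar.isCovariantDerivativeOn.leibniz S.mdifferentiableAt_xi hw, add_apply, smul_apply,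
    ContinuousLinearMap.smulRight_apply, mvfderiv_exp, e, mul_smul, ← smul_add,
    smul_eq_zero] at h2
  have h3 := h2.resolve_left (Real.exp_pos _).ne'
  rw [difference_apply S.mdifferentiableAt_xi, sub_apply, hD.xi, sub_zero]
  rwa [neg_apply, neg_smul, ← sub_eq_add_neg, sub_eq_zero] at h3

/-- `DBar` annihilates ḡ, whereas along ker η the `D`-derivative of ḡ comes only from dα and dβ; the
η ⊗ η term has a zero of order two there. -/
theorem difference_g (hD : S.IsNatural D) (hDBar : (S.transform a).IsNatural DBar)
    (x y z : TangentSpace 𝓘(ℝ, E) p) (hy : S.eta p y = 0) (hz : S.eta p z = 0) :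
    S.gBar a p (DBar.difference D p y x) z + S.gBar a p y (DBar.difference D p z x)
      = 2 * (mvfderiv 𝓘(ℝ, E) a.1 p x * S.gBar a p y z
        + mvfderiv 𝓘(ℝ, E) a.2.1 p x * S.gBar a p y (S.phi p z)) := by
  obtain ⟨Y, hY, rfl⟩ := exists_field y
  obtain ⟨Z, hZ, rfl⟩ := exists_field z
  have hZ' := S.mdifferentiableAt_phiField hZ
  have h := hDBar.g hY hZ x
  have hα := (smooth_alpha a).mdifferentiableAt (x := p) (by simp)
  have hβ := (smooth_beta a).mdifferentiableAt (x := p) (by simp)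
  have hγ := (smooth_gamma a).mdifferentiableAt (x := p) (by simp)
  have h1 := S.mdifferentiableAt_g hY hZ
  have h2 := S.mdifferentiableAt_g hY hZ'
  have h3 := S.mdifferentiableAt_eta hY
  have h4 := S.mdifferentiableAt_eta hZ
  have e : (fun q ↦ (S.transform a).g q (Y q) (Z q))
      = alpha a * (fun q ↦ S.g q (Y q) (Z q)) + beta a * (fun q ↦ S.g q (Y q) (S.phiField Z q))
        + (gamma a - alpha a) * ((fun q ↦ S.eta q (Y q)) * fun q ↦ S.eta q (Z q)) :=
    funext fun q ↦ S.gBar_apply a q (Y q) (Z q)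
  rw [e, mvfderiv_add ((hα.mul h1).add (hβ.mul h2)) ((hγ.sub hα).mul (h3.mul h4)),
    mvfderiv_add (hα.mul h1) (hβ.mul h2), mvfderiv_mul hα h1, mvfderiv_mul hβ h2,
    mvfderiv_mul (hγ.sub hα) (h3.mul h4), mvfderiv_mul h3 h4] at h
  change _ = S.gBar a p _ _ + S.gBar a p _ _ at h
  simp only [add_apply, smul_apply, smul_eq_mul, hD.g hY hZ, hD.g hY hZ', hD.phi hZ,
    mvfderiv_alpha, mvfderiv_beta, Pi.mul_apply, hy, hz] at h
  rw [difference_apply hY, difference_apply hZ]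
  simp only [sub_apply, map_sub, gBar_apply, phiField, hy, hz, S.phi_phi, zero_smul, add_zero,
    map_neg] at h ⊢
  linear_combination -h

theorem transform_torsion_eq_iff (hD : S.IsPhiCanonical D)
    (hDBar : (S.transform a).IsPhiCanonical DBar) (hE : 1 < Module.finrank ℝ E) :
    DBar.torsion = D.torsion ↔ a ∈ S.G0 := by
  have hexp : ∀ t : ℝ, Real.exp t ≠ 0 := fun t ↦ (Real.exp_pos t).ne'
  have key : ∀ p : M, DBar.torsion p = D.torsion p ↔
      (∀ x : TangentSpace 𝓘(ℝ, E) p,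
        mvfderiv 𝓘(ℝ, E) a.1 p (S.phi p (S.phi p x)) + mvfderiv 𝓘(ℝ, E) a.2.1 p (S.phi p x) = 0) ∧
      (∀ x : TangentSpace 𝓘(ℝ, E) p,
        mvfderiv 𝓘(ℝ, E) a.1 p (S.phi p x) - mvfderiv 𝓘(ℝ, E) a.2.1 p (S.phi p (S.phi p x)) = 0) ∧
      mvfderiv 𝓘(ℝ, E) a.1 p (S.xi p) = 0 ∧ mvfderiv 𝓘(ℝ, E) a.2.1 p (S.xi p) = 0 ∧
      ∀ x : TangentSpace 𝓘(ℝ, E) p, mvfderiv 𝓘(ℝ, E) a.2.2 p (S.phi p x) = 0 := by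
    intro p
    -- Dimension above one makes ker η nonzero; otherwise no horizontal vector would detect `du ξ`
    -- and `dv ξ`.
    obtain ⟨v, hv, hv0⟩ : ∃ v : TangentSpace 𝓘(ℝ, E) p, S.eta p v = 0 ∧ v ≠ 0 := by
      by_contra! hc
      have hinj : Function.Injective (S.eta p : TangentSpace 𝓘(ℝ, E) p →ₗ[ℝ] ℝ) :=
        (injective_iff_map_eq_zero _).2 hc
      have h1 := LinearMap.finrank_le_finrank_of_injective (M := E) hinj
      rw [Module.finrank_self] at h1
      exact absurd hE (not_lt.2 h1)
    have hT' := hDBar.isCanonicalTorsion p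
    -- The torsion of `D` is moved to the transformed structure, where it can be subtracted from
    -- that of `DBar`.
    have hT := (show IsCanonicalTorsion (S.phi p) (S.xi p) (S.eta p) (S.g p) fun x y ↦
      (LinearMap.mk₂ ℝ (fun x y ↦ D.torsion p x y) (by simp) (by simp) (by simp) (by simp)) x y from
      hD.isCanonicalTorsion p).conformal (S.isBMetricSpace p) (ξ' := (S.transform a).xi p)
        (η' := (S.transform a).eta p) (g' := S.gBar a p) rfl (fun _ ↦ rfl) (hexp (a.2.2 p))
        (S.gBar_apply a p)
    refine Iff.trans ?_ <| (symmetric_difference_iff ((S.transform a).isBMetricSpace p)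
      (s := LinearMap.mk₂ ℝ (fun x y ↦ DBar.difference D p y x) (by simp) (by simp) (by simp)
        (by simp))
      (du := mvfderiv 𝓘(ℝ, E) a.1 p) (dv := mvfderiv 𝓘(ℝ, E) a.2.1 p)
      (dw := mvfderiv 𝓘(ℝ, E) a.2.2 p)
      (fun x y ↦ difference_phi hD.isNatural hDBar.isNatural x y)
      (fun x ↦ ?_) (fun x y ↦ ?_) (fun x y z hy hz ↦ ?_) ?_ (h := v) (by simp [transform, hv]) hv0).trans ?_
    · simp only [LinearMap.mk₂_apply]
      rw [ContinuousLinearMap.ext_iff]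
      refine forall_congr' fun x ↦ ?_
      rw [ContinuousLinearMap.ext_iff]
      refine forall_congr' fun y ↦ ?_
      rw [← sub_eq_zero, torsion_sub_torsion, sub_eq_zero]
    · simp only [LinearMap.mk₂_apply]
      change DBar.difference D p (Real.exp _ • S.xi p) x = _ • Real.exp _ • S.xi p
      rw [map_smul, smul_apply, difference_xi hD.isNatural hDBar.isNatural, smul_comm]
    · simp only [LinearMap.mk₂_apply]
      change Real.exp _ * S.eta p _ = _ * (Real.exp _ * S.eta p y)
      rw [difference_eta hD.isNatural hDBar.isNatural]
      ring
    · exact difference_g hD.isNatural hDBar.isNatural x y z (by simpa [transform] using hy)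
        (by simpa [transform] using hz)
    · simp only [LinearMap.mk₂_apply, ← torsion_sub_torsion]
      exact hT'.sub hT
    -- The conditions arrive for the rescaled ξ; its factor is a nonzero exponential.
    · change _ ∧ _ ∧ mvfderiv 𝓘(ℝ, E) a.1 p (Real.exp _ • S.xi p) = 0 ∧
        mvfderiv 𝓘(ℝ, E) a.2.1 p (Real.exp _ • S.xi p) = 0 ∧ _ ↔ _
      rw [map_smul, map_smul, smul_eq_zero_iff_right (hexp _), smul_eq_zero_iff_right (hexp _)]
      rfl
  rw [funext_iff]
  exact forall_congr' key

end transform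

end

end AlmostContactBMetric

theorem mainTheorem1 (n : ℕ) (hn : 1 ≤ n)
    {M : Type*} [TopologicalSpace M] [ChartedSpace (EuclideanSpace ℝ (Fin (2 * n + 1))) M]
    [IsManifold (𝓡 (2 * n + 1)) ∞ M]
    (S : AlmostContactBMetric (EuclideanSpace ℝ (Fin (2 * n + 1))) M)
    (a : AlmostContactBMetric.ConformalParam (EuclideanSpace ℝ (Fin (2 * n + 1))) M)
    (D DBar : CovariantDerivative (𝓡 (2 * n + 1)) (EuclideanSpace ℝ (Fin (2 * n + 1)))
      (TangentSpace (𝓡 (2 * n + 1)) : M → Type _))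
    (hD : S.IsPhiCanonical D) (hDBar : (S.transform a).IsPhiCanonical DBar) :
    DBar.torsion = D.torsion ↔ a ∈ S.G0 := by
  refine AlmostContactBMetric.transform_torsion_eq_iff hD hDBar ?_
  rw [finrank_euclideanSpace_fin]
  omega
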